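/- Let $A\in\mathbb{C}^{N\times N}$, $v\in\mathbb{C}^N$, and let $\mathcal{K}_j(A,v)=\mathrm{span}\{v,Av,\dots,A^{j-1}v\}$ denote the Krylov subspaces. Let a Krylov-like decomposition of $A$ with respect to $\mathcal{K}_m(A,v)$ be given, that is, $$AW=WK+w\,k^{T},$$ where $K\in\mathbb{C}^{(m+l)\times(m+l)}$, $W\in\mathbb{C}^{N\times(m+l)}$ with $\mathrm{range}(W)=\mathcal{K}_m(A,v)$, $w\in\mathcal{K}_{m+1}(A,v)\setminus\mathcal{K}_m(A,v)$ and $k\in\mathbb{C}^{m+l}$. Let $\hat b\in\mathbb{C}^{m+l}$ be any vector with $W\hat b=v$. Let $\Omega\subseteq\mathbb{C}$ be a closed convex set that contains the fields of values $F(A)$ and $F(K)$, where $F(B)=\{x^*Bx: x^*x=1\}$, and let $f$ be analytic on $\Omega$ including its boundary (that is, in a neighbourhood of each point of $\Omega$). Matrix functions are defined by Hermite interpolation: $f(B)=p(B)$, where $p$ is the unique polynomial with $\deg p<\deg q_B$ ($q_B$ the minimal polynomial of $B$) such that $p^{(j)}(\lambda)=f^{(j)}(\lambda)$ for every root $\lambda$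 of $q_B$ and all $j$ smaller than its multiplicity in $q_B$. Let $z_0,z_1,\dots\in\Omega$, put $q_0(z)=1$, $q_j(z)=(z-z_0)\cdots(z-z_{j-1})$ for $j\ge1$, and define $$\phi_0=f,\qquad \phi_{j+1}(z)=\frac{\phi_j(z)-\phi_j(z_j)}{z-z_j}\quad(j\ge0),$$ where the value at $z=z_j$ is defined by continuity, i.e. $\phi_{j+1}(z_j)=\phi_j'(z_j)$. (1) If there is a constant $C>0$ with $|f^{(j)}(z)|\le C$ for all $z\in\Omega$ and all $j\ge0$, and the sequence $(z_i)$ is bounded (which is automatic if $\Omega$ is bounded), then the error of the Krylov-like approximation satisfies $$f(A)v-Wf(K)\hat b=\sum_{j=1}^{\infty}\bigl(k^{T}\phi_j(K)\hat b\bigr)\,q_{j-1}(A)w,$$ where the series converges unconditionally in $\mathbb{C}^N$. (2) If $z_0,\dots,z_{N-1}$ are the $N$ eigenvalues of $A$, counted with algebraic multiplicity, then, without assuming the bounds in (1), all terms of this series with $j>N$ vanish, and $$f(A)v-Wf(K)\hat b=\sum_{j=1}^{N}\bigl(k^{T}\phi_j(K)\hat b\bigr)\,q_{j-1}(A)w.$$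 -/

import Mathlib

open Polynomial Matrix

/-- `p` is a Hermite interpolant of `f` at the roots of `q`, counted with multiplicity: `p` has
degree less than `deg q`, and `p^(j)(a) = f^(j)(a)` for each root `a` of `q` and each `j` less than
the multiplicity of `a`. -/
def IsHermiteInterpolant (f : ℂ → ℂ) (q p : ℂ[X]) : Prop :=
  p.degree < q.degree ∧
    ∀ a : ℂ, ∀ j < q.rootMultiplicity a, (derivative^[j] p).eval a = iteratedDeriv j f a

/-- Evaluation of the derivatives of `p` at the roots of `q`, on polynomials of degree less than
`deg q`. -/
noncomputable def hermiteData (q : ℂ[X]) :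
    degreeLT ℂ q.natDegree →ₗ[ℂ]
      ((Σ a : {a // a ∈ q.roots.toFinset}, Fin (q.rootMultiplicity a.1)) → ℂ) where
  toFun p s := (derivative^[s.2.1] p.1).eval s.1.1
  map_add' p r := by
    funext s
    simp [iterate_map_add]
  map_smul' c p := by
    funext s
    simp [iterate_derivative_smul]

theorem le_degree_of_iterate_derivative_eq_zero {q p : ℂ[X]} (hp : p ≠ 0)
    (h : ∀ a : ℂ, ∀ j < q.rootMultiplicity a, (derivative^[j] p).eval a = 0) :
    q.natDegree ≤ p.natDegree := by
  have hle : q.roots ≤ p.roots := by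
    rw [Multiset.le_iff_count]
    intro a
    rw [count_roots, count_roots]
    rcases Nat.eq_zero_or_pos (q.rootMultiplicity a) with h0 | h0
    · omega
    · have := lt_rootMultiplicity_of_isRoot_iterate_derivative (p := p) (t := a)
        (n := q.rootMultiplicity a - 1) hp (fun j hj => h a j (by omega))
      omega
  have h1 := Multiset.card_le_card hle
  have h2 : q.roots.card = q.natDegree := (IsAlgClosed.splits q).natDegree_eq_card_roots.symm
  have h3 := card_roots' p
  omega

theorem hermiteData_injective (q : ℂ[X]) : Function.Injective (hermiteData q) := by
  rw [← LinearMap.ker_eq_bot, LinearMap.ker_eq_bot']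
  rintro ⟨p, hp⟩ h0
  by_contra hne
  have hp0 : p ≠ 0 := fun h => hne (Subtype.ext h)
  have hq : q ≠ 0 := by
    rintro rfl
    rw [mem_degreeLT] at hp
    simp at hp
    exact hp0 hp
  have := le_degree_of_iterate_derivative_eq_zero (q := q) hp0 (by
    intro a j hj
    have ha : a ∈ q.roots.toFinset := by
      rw [Multiset.mem_toFinset, ← Multiset.count_pos, count_roots]
      omega
    exact congrFun h0 ⟨⟨a, ha⟩, ⟨j, hj⟩⟩)
  rw [mem_degreeLT, degree_eq_natDegree hp0] at hp
  have := Nat.cast_lt.mp hp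
  omega

theorem hermiteData_surjective (q : ℂ[X]) : Function.Surjective (hermiteData q) := by
  have : FiniteDimensional ℂ (degreeLT ℂ q.natDegree) :=
    (degreeLTEquiv ℂ q.natDegree).symm.finiteDimensional
  refine (LinearMap.injective_iff_surjective_of_finrank_eq_finrank ?_).mp
    (hermiteData_injective q)
  rw [(degreeLTEquiv ℂ q.natDegree).finrank_eq, Module.finrank_fin_fun,
    Module.finrank_fintype_fun_eq_card, Fintype.card_sigma]
  simp only [Fintype.card_fin]
  rw [Finset.sum_coe_sort q.roots.toFinset (fun a => q.rootMultiplicity a)]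
  simp only [← count_roots]
  rw [Multiset.toFinset_sum_count_eq]
  exact (IsAlgClosed.splits q).natDegree_eq_card_roots

theorem existsUnique_hermiteInterpolant (f : ℂ → ℂ) {q : ℂ[X]} (hq : q ≠ 0) :
    ∃! p, IsHermiteInterpolant f q p := by
  obtain ⟨p, hp⟩ := hermiteData_surjective q (fun s => iteratedDeriv s.2.1 f s.1.1)
  refine ⟨p.1, ⟨?_, ?_⟩, ?_⟩
  · rw [degree_eq_natDegree hq]
    exact mem_degreeLT.mp p.2
  · intro a j hj
    have ha : a ∈ q.roots.toFinset := by
      rw [Multiset.mem_toFinset, ← Multiset.count_pos, count_roots]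
      omega
    exact congrFun hp ⟨⟨a, ha⟩, ⟨j, hj⟩⟩
  · rintro r ⟨hr, hr'⟩
    have hr1 : r ∈ degreeLT ℂ q.natDegree := by
      rw [mem_degreeLT, ← degree_eq_natDegree hq]
      exact hr
    have : (⟨r, hr1⟩ : degreeLT ℂ q.natDegree) = p := by
      apply hermiteData_injective q
      rw [hp]
      funext s
      exact hr' s.1.1 s.2.1 s.2.2
    exact congrArg Subtype.val this

theorem minpoly_matrix_ne_zero {n : ℕ} (A : Matrix (Fin n) (Fin n) ℂ) : minpoly ℂ A ≠ 0 :=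
  minpoly.ne_zero (Algebra.IsIntegral.isIntegral A)

/-- The polynomial interpolating `f` in the Hermite sense at the roots of the minimal polynomial
of `A`. -/
noncomputable def hermiteInterpolant {n : ℕ} (f : ℂ → ℂ) (A : Matrix (Fin n) (Fin n) ℂ) : ℂ[X] :=
  (existsUnique_hermiteInterpolant f (minpoly_matrix_ne_zero A)).choose

theorem hermiteInterpolant_spec {n : ℕ} (f : ℂ → ℂ) (A : Matrix (Fin n) (Fin n) ℂ) :
    IsHermiteInterpolant f (minpoly ℂ A) (hermiteInterpolant f A) :=
  (existsUnique_hermiteInterpolant f (minpoly_matrix_ne_zero A)).choose_spec.1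

/-- The matrix function `f(A) = p(A)`, where `p` is the Hermite interpolating polynomial of `f` at
the eigenvalues of `A`, with the multiplicities they have in the minimal polynomial. -/
noncomputable def matrixFunction {n : ℕ} (f : ℂ → ℂ) (A : Matrix (Fin n) (Fin n) ℂ) :
    Matrix (Fin n) (Fin n) ℂ :=
  aeval A (hermiteInterpolant f A)

/-- The field of values `F(A) = {x^* A x : x^* x = 1}`. -/
def fieldOfValues {n : ℕ} (A : Matrix (Fin n) (Fin n) ℂ) : Set ℂ :=
  {c | ∃ x : Fin n → ℂ, star x ⬝ᵥ x = 1 ∧ c = star x ⬝ᵥ (A *ᵥ x)}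

/-- The Krylov subspace spanned by `v, A v, …, A^(m-1) v`. -/
def krylovSubspace {N : ℕ} (A : Matrix (Fin N) (Fin N) ℂ) (v : Fin N → ℂ) (m : ℕ) :
    Submodule ℂ (Fin N → ℂ) :=
  Submodule.span ℂ (Set.range fun j : Fin m => (A ^ (j : ℕ)) *ᵥ v)

/-- A Krylov-like decomposition `A W = W K + w kᵀ` of `A` with respect to the `m`-th Krylov
subspace of `A` and `v`. -/
structure IsKrylovLikeDecomposition {N : ℕ} (A : Matrix (Fin N) (Fin N) ℂ) (v : Fin N → ℂ)
    (m l : ℕ) (W : Matrix (Fin N) (Fin (m + l)) ℂ) (K : Matrix (Fin (m + l)) (Fin (m + l)) ℂ)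
    (w : Fin N → ℂ) (k : Fin (m + l) → ℂ) : Prop where
  decomposition : A * W = W * K + vecMulVec w k
  range_eq : LinearMap.range W.mulVecLin = krylovSubspace A v m
  mem_succ : w ∈ krylovSubspace A v (m + 1)
  notMem : w ∉ krylovSubspace A v m

/-- The functions `φ₀ = f`, `φ_{k+1}(ζ) = (φ_k(ζ) - φ_k(z_k)) / (ζ - z_k)`. At `ζ = z_k`, the
quotient is given its limit `φ_k'(z_k)`, which is what `dslope` does. -/
noncomputable def phiSeq (f : ℂ → ℂ) (z : ℕ → ℂ) : ℕ → ℂ → ℂ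
  | 0 => f
  | k + 1 => dslope (phiSeq f z k) (z k)

/-- The polynomials `q₀ = 1`, `q_k = (X - z₀) ⋯ (X - z_{k-1})`. -/
noncomputable def nodePoly (z : ℕ → ℂ) (k : ℕ) : ℂ[X] :=
  ∏ i ∈ Finset.range k, (X - C (z i))

/-- The error `f(A) v - W f(K) b` of the Krylov-like approximation. -/
noncomputable def krylovError {N n : ℕ} (A : Matrix (Fin N) (Fin N) ℂ) (v : Fin N → ℂ)
    (W : Matrix (Fin N) (Fin n) ℂ) (K : Matrix (Fin n) (Fin n) ℂ) (b : Fin n → ℂ)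
    (f : ℂ → ℂ) : Fin N → ℂ :=
  matrixFunction f A *ᵥ v - W *ᵥ (matrixFunction f K *ᵥ b)

/-- The `j`-th term `kᵀ φ_j(K) b · q_{j-1}(A) w` of the error expansion, `j ≥ 1`. -/
noncomputable def expansionTerm {N n : ℕ} (A : Matrix (Fin N) (Fin N) ℂ)
    (K : Matrix (Fin n) (Fin n) ℂ) (w : Fin N → ℂ) (k b : Fin n → ℂ)
    (f : ℂ → ℂ) (z : ℕ → ℂ) (j : ℕ) : Fin N → ℂ :=
  (k ⬝ᵥ (matrixFunction (phiSeq f z j) K *ᵥ b)) • (aeval A (nodePoly z (j - 1)) *ᵥ w)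

/-! From `f(x) = f(z₀) + (x - z₀) φ₁(x)` one gets `f(A) = f(z₀) + (A - z₀) φ₁(A)`, and likewise for
`K` (`matrixFunction_eq_add_mul_dslope`). In the error the constants cancel because `W b = v`, and
moving `A` past `W` leaves one multiple of `w`: the error for `f` is `(kᵀ φ₁(K) b) w` plus `A - z₀`
applied to the error for `φ₁` (`krylovError_eq_add_mulVec_dslope`). Iterating gives the partial sum
plus the remainder `q_r(A)` times the error for `φ_r`.

If the nodes are the eigenvalues of `A`, Cayley-Hamilton kills `q_r(A)` for `r ≥ N`. Under uniform
derivative bounds, each divided difference gains a factor in the derivative estimate, so matrix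
functions of `φ_r` are `O(1/r!)`, while `q_r(A)` grows at most geometrically. The series then
converges absolutely and the remainder tends to zero. -/

/-! ### Eigenvalues and Hermite interpolation -/

/-- Take the Rayleigh quotient of a unit eigenvector. This carries analyticity and derivative bounds
from `Ω` to the interpolation points. -/
theorem mem_fieldOfValues_of_isRoot_minpoly {n : ℕ} {A : Matrix (Fin n) (Fin n) ℂ} {a : ℂ}
    (ha : (minpoly ℂ A).IsRoot a) : a ∈ fieldOfValues A := by
  rw [← Matrix.minpoly_toLin'] at ha
  obtain ⟨x, hx⟩ := (Module.End.hasEigenvalue_of_isRoot ha).exists_hasEigenvector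
  have hAx : A *ᵥ x = a • x := by simpa using hx.apply_eq_smul
  have hsum : star x ⬝ᵥ x = ((∑ i, ‖x i‖ ^ 2 : ℝ) : ℂ) := by
    simp [dotProduct, Complex.conj_mul']
  set s : ℝ := ∑ i, ‖x i‖ ^ 2 with hs
  have hs0 : 0 ≤ s := Finset.sum_nonneg fun i _ => sq_nonneg _
  have hsne : s ≠ 0 := by
    intro h
    exact hx.2 (funext fun i => by
      have := (Finset.sum_eq_zero_iff_of_nonneg fun i _ => sq_nonneg ‖x i‖).mp h i
        (Finset.mem_univ i)
      simpa using this)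
  have hnorm : star (((√s)⁻¹ : ℂ) • x) ⬝ᵥ (((√s)⁻¹ : ℂ) • x) = 1 := by
    rw [star_smul, smul_dotProduct, dotProduct_smul, hsum, smul_smul, smul_eq_mul]
    have h1 : star ((√s : ℂ)⁻¹) = (√s : ℂ)⁻¹ := by simp
    rw [h1, ← Complex.ofReal_inv, ← Complex.ofReal_mul, ← Complex.ofReal_mul,
      ← mul_inv, Real.mul_self_sqrt hs0, inv_mul_cancel₀ hsne, Complex.ofReal_one]
  refine ⟨((√s)⁻¹ : ℂ) • x, hnorm, ?_⟩
  rw [mulVec_smul, hAx, smul_comm, dotProduct_smul, hnorm, smul_eq_mul, mul_one]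

/-- No degree bound is needed on `r`: two polynomials with the same Hermite data differ by a
multiple of the minimal polynomial. -/
theorem matrixFunction_eq_aeval {n : ℕ} {A : Matrix (Fin n) (Fin n) ℂ} {f : ℂ → ℂ} {r : ℂ[X]}
    (h : ∀ a : ℂ, ∀ j < (minpoly ℂ A).rootMultiplicity a,
      (derivative^[j] r).eval a = iteratedDeriv j f a) :
    matrixFunction f A = aeval A r := by
  rw [matrixFunction, ← sub_eq_zero, ← map_sub]
  obtain ⟨-, hp⟩ := hermiteInterpolant_spec f A
  by_cases hs : hermiteInterpolant f A - r = 0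
  · rw [hs, map_zero]
  have hdvd : minpoly ℂ A ∣ hermiteInterpolant f A - r := by
    refine (IsAlgClosed.splits _).dvd_of_roots_le_roots (minpoly_matrix_ne_zero A) ?_
    rw [Multiset.le_iff_count]
    intro a
    rw [count_roots, count_roots]
    rcases Nat.eq_zero_or_pos ((minpoly ℂ A).rootMultiplicity a) with h0 | h0
    · omega
    · have := lt_rootMultiplicity_of_isRoot_iterate_derivative (t := a)
        (n := (minpoly ℂ A).rootMultiplicity a - 1) hs (fun j hj => by
          rw [IsRoot, iterate_derivative_sub, eval_sub, hp a j (by omega), h a j (by omega),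
            sub_self])
      omega
  obtain ⟨s, hs⟩ := hdvd
  rw [hs, map_mul, minpoly.aeval, zero_mul]

/-! ### Divided differences and their derivatives -/

theorem Polynomial.iteratedDeriv_eval (p : ℂ[X]) (j : ℕ) (a : ℂ) :
    iteratedDeriv j (fun x => p.eval x) a = (derivative^[j] p).eval a := by
  induction j generalizing p with
  | zero => simp
  | succ j ih =>
    rw [iteratedDeriv_succ', Function.iterate_succ_apply, ← ih]
    congr 1
    funext x
    exact p.deriv

theorem AnalyticAt.hasDerivAt_iteratedDeriv {h : ℂ → ℂ} {a : ℂ} (ha : AnalyticAt ℂ h a) (j : ℕ) :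
    HasDerivAt (iteratedDeriv j h) (iteratedDeriv (j + 1) h a) a := by
  rw [iteratedDeriv_succ, iteratedDeriv_eq_iterate]
  exact (ha.iterated_deriv j).differentiableAt.hasDerivAt

/-- Leibniz rule with a linear factor. At `j = 0` the truncated index `j - 1` is harmless, since its
coefficient vanishes. -/
theorem iteratedDeriv_add_sub_mul {h : ℂ → ℂ} (c z₀ : ℂ) (j : ℕ) {a : ℂ} (ha : AnalyticAt ℂ h a) :
    iteratedDeriv j (fun x => c + (x - z₀) * h x) a =
      iteratedDeriv j (fun _ => c) a + (a - z₀) * iteratedDeriv j h a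
        + j * iteratedDeriv (j - 1) h a := by
  induction j generalizing a with
  | zero => simp
  | succ j ih =>
    have hev := ha.eventually_analyticAt.mono fun x hx => ih hx
    have hd : ∀ i, HasDerivAt (iteratedDeriv i h) (iteratedDeriv (i + 1) h a) a := 
      ha.hasDerivAt_iteratedDeriv
    have hc : HasDerivAt (iteratedDeriv j (fun _ : ℂ => c)) (iteratedDeriv (j + 1) (fun _ => c) a)
        a :=
      analyticAt_const.hasDerivAt_iteratedDeriv j
    rw [iteratedDeriv_succ, Filter.EventuallyEq.deriv_eq hev]
    refine ((hc.add (((hasDerivAt_id a).sub_const z₀).mul (hd j))).add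
      ((hd (j - 1)).const_mul (j : ℂ))).deriv.trans ?_
    -- The index `j - 1 + 1` equals `j` only for `j > 0`.
    rcases j with _ | j
    · simp; ring
    · simp only [Nat.add_sub_cancel, id]
      push_cast
      ring

theorem eq_add_sub_mul_dslope (f : ℂ → ℂ) (z₀ : ℂ) :
    f = fun x => f z₀ + (x - z₀) * dslope f z₀ x := by
  funext x
  rw [← smul_eq_mul, sub_smul_dslope]
  ring

theorem AnalyticAt.dslope_of_analyticAt {f : ℂ → ℂ} {z₀ a : ℂ} (h₀ : AnalyticAt ℂ f z₀)
    (ha : AnalyticAt ℂ f a) : AnalyticAt ℂ (dslope f z₀) a := by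
  by_cases h : a = z₀
  · subst h
    obtain ⟨p, hp⟩ := h₀
    exact hp.has_fpower_series_dslope_fslope.analyticAt
  · refine AnalyticAt.congr ?_ (dslope_eventuallyEq_slope_of_ne f h).symm
    simp only [slope_fun_def, vsub_eq_sub]
    exact ((analyticAt_id.sub analyticAt_const).inv (sub_ne_zero.mpr h)).smul
      (ha.sub analyticAt_const)

/-- If `p` interpolates the divided difference, then `f(z₀) + (X - z₀) p` has the Hermite data of
`f`: the Leibniz formula expresses both sides through the same data of orders `j` and `j - 1`. -/
theorem matrixFunction_eq_add_mul_dslope {n : ℕ} {A : Matrix (Fin n) (Fin n) ℂ} {f : ℂ → ℂ}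
    {z₀ : ℂ} (h₀ : AnalyticAt ℂ f z₀) (hA : ∀ a ∈ fieldOfValues A, AnalyticAt ℂ f a) :
    matrixFunction f A = algebraMap ℂ _ (f z₀)
      + (A - algebraMap ℂ _ z₀) * matrixFunction (dslope f z₀) A := by
  rw [matrixFunction_eq_aeval (r := C (f z₀) + (X - C z₀) * hermiteInterpolant (dslope f z₀) A),
    map_add, map_mul, map_sub, aeval_C, aeval_X, aeval_C, matrixFunction]
  intro a j hj
  have hroot : (minpoly ℂ A).IsRoot a :=
    (rootMultiplicity_pos (minpoly_matrix_ne_zero A)).mp (by omega)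
  have han : AnalyticAt ℂ (dslope f z₀) a :=
    h₀.dslope_of_analyticAt (hA a (mem_fieldOfValues_of_isRoot_minpoly hroot))
  have hp := (hermiteInterpolant_spec (dslope f z₀) A).2 a
  have hpa : AnalyticAt ℂ (fun x => (hermiteInterpolant (dslope f z₀) A).eval x) a :=
    AnalyticOnNhd.eval_polynomial _ a trivial
  conv_rhs => rw [eq_add_sub_mul_dslope f z₀]
  rw [iteratedDeriv_add_sub_mul _ _ _ han, ← hp j hj, ← hp (j - 1) (by omega),
    ← Polynomial.iteratedDeriv_eval, ← Polynomial.iteratedDeriv_eval,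
    ← Polynomial.iteratedDeriv_eval, ← iteratedDeriv_add_sub_mul _ _ _ hpa]
  simp

/-- Write `h` for the divided difference and `γ(t) = z₀ + t(ζ - z₀)`, a segment in `Ω` by convexity.
Then `t^(j+1) h^(j)(γ(t))` has derivative `t^j f^(j+1)(γ(t))`, and integrating `M t^j` over `[0, 1]`
gives `M / (j + 1)`. -/
theorem norm_iteratedDeriv_dslope_le {Ω : Set ℂ} (hconvex : Convex ℝ Ω) {f : ℂ → ℂ}
    (hf : AnalyticOnNhd ℂ f Ω) {z₀ : ℂ} (hz₀ : z₀ ∈ Ω) {j : ℕ} {M : ℝ}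
    (hM : ∀ ζ ∈ Ω, ‖iteratedDeriv (j + 1) f ζ‖ ≤ M) {ζ : ℂ} (hζ : ζ ∈ Ω) :
    ‖iteratedDeriv j (dslope f z₀) ζ‖ ≤ M / (j + 1) := by
  set h := dslope f z₀
  have hmem : ∀ t ∈ Set.Icc (0 : ℝ) 1, z₀ + t * (ζ - z₀) ∈ Ω := fun t ht => by
    have := hconvex.add_smul_sub_mem hz₀ hζ ht
    simpa using this
  have han : ∀ t ∈ Set.Icc (0 : ℝ) 1, AnalyticAt ℂ h (z₀ + t * (ζ - z₀)) := fun t ht =>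
    (hf z₀ hz₀).dslope_of_analyticAt (hf _ (hmem t ht))
  have hderiv : ∀ t ∈ Set.Icc (0 : ℝ) 1,
      HasDerivAt (fun t : ℝ => (t : ℂ) ^ (j + 1) * iteratedDeriv j h (z₀ + t * (ζ - z₀)))
        ((t : ℂ) ^ j * iteratedDeriv (j + 1) f (z₀ + t * (ζ - z₀))) t := fun t ht => by
    have h1 := (han t ht).hasDerivAt_iteratedDeriv j
    have h2 : HasDerivAt (fun s : ℂ => z₀ + s * (ζ - z₀)) (ζ - z₀) (t : ℂ) := by
      simpa using ((hasDerivAt_id (t : ℂ)).mul_const (ζ - z₀)).const_add z₀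
    have h3 := ((hasDerivAt_pow (j + 1) (t : ℂ)).mul (h1.comp (t : ℂ) h2)).comp_ofReal
    refine h3.congr_deriv ?_
    conv_rhs => rw [eq_add_sub_mul_dslope f z₀, iteratedDeriv_add_sub_mul _ _ _ (han t ht)]
    simp only [Nat.add_sub_cancel, iteratedDeriv_const]
    push_cast
    simp
    ring
  have hB : ∀ t : ℝ, HasDerivAt (fun t => M / (j + 1) * t ^ (j + 1)) (M * t ^ j) t := fun t => by
    refine ((hasDerivAt_pow (j + 1) t).const_mul (M / (j + 1))).congr_deriv ?_
    have : (j + 1 : ℝ) ≠ 0 := by positivity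
    rw [Nat.add_sub_cancel]
    push_cast
    field_simp
  have hbound := image_norm_le_of_norm_deriv_right_le_deriv_boundary (a := (0 : ℝ)) (b := 1)
    (B := fun t => M / (j + 1) * t ^ (j + 1)) (B' := fun t => M * t ^ j)
    (fun t ht => (hderiv t ht).continuousAt.continuousWithinAt)
    (fun t ht => (hderiv t ⟨ht.1, ht.2.le⟩).hasDerivWithinAt) (by simp)
    hB
    (fun t ht => by
      rw [norm_mul, norm_pow, Complex.norm_real, Real.norm_of_nonneg ht.1, mul_comm]
      exact mul_le_mul_of_nonneg_right (hM _ (hmem t ⟨ht.1, ht.2.le⟩)) (pow_nonneg ht.1 _))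
    (Set.right_mem_Icc.mpr zero_le_one)
  simpa using hbound

/-! ### Factorial decay of the iterated divided differences -/

theorem analyticOnNhd_phiSeq {f : ℂ → ℂ} {Ω : Set ℂ} (hf : AnalyticOnNhd ℂ f Ω) {z : ℕ → ℂ}
    (hz : ∀ i, z i ∈ Ω) (n : ℕ) : AnalyticOnNhd ℂ (phiSeq f z n) Ω := by
  induction n with
  | zero => exact hf
  | succ n ih => exact fun a ha => (ih _ (hz n)).dslope_of_analyticAt (ih a ha)

open Nat in
theorem norm_iteratedDeriv_phiSeq_le {f : ℂ → ℂ} {Ω : Set ℂ} (hconvex : Convex ℝ Ω)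
    (hf : AnalyticOnNhd ℂ f Ω) {z : ℕ → ℂ} (hz : ∀ i, z i ∈ Ω) {M : ℝ}
    (hM : ∀ j, ∀ ζ ∈ Ω, ‖iteratedDeriv j f ζ‖ ≤ M) (n j : ℕ) {ζ : ℂ} (hζ : ζ ∈ Ω) :
    ‖iteratedDeriv j (phiSeq f z n) ζ‖ ≤ M * j ! / (n + j)! := by
  induction n generalizing j ζ with
  | zero =>
    have : (j ! : ℝ) ≠ 0 := by positivity
    simpa [this, phiSeq] using hM j ζ hζ
  | succ n ih =>
    refine (norm_iteratedDeriv_dslope_le hconvex (analyticOnNhd_phiSeq hf hz n) (hz n)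
      (fun ζ hζ => ih (j + 1) hζ) hζ).trans_eq ?_
    rw [show n + (j + 1) = n + 1 + j by ring, Nat.factorial_succ j]
    push_cast
    field_simp

/-- Values of a linear map on matrix functions are controlled by the Hermite data. -/
theorem exists_norm_map_matrixFunction_le {n : ℕ} (A : Matrix (Fin n) (Fin n) ℂ) {E : Type*}
    [SeminormedAddCommGroup E] [NormedSpace ℂ E] (T : Matrix (Fin n) (Fin n) ℂ →ₗ[ℂ] E) :
    ∃ M : ℝ, 0 ≤ M ∧ ∀ (g : ℂ → ℂ) (B : ℝ),
      (∀ a, (minpoly ℂ A).IsRoot a → ∀ j, ‖iteratedDeriv j g a‖ ≤ B * j.factorial) →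
        ‖T (matrixFunction g A)‖ ≤ M * B := by
  let e := LinearEquiv.ofBijective (hermiteData (minpoly ℂ A))
    ⟨hermiteData_injective _, hermiteData_surjective _⟩
  let S : ((Σ a : {a // a ∈ (minpoly ℂ A).roots.toFinset},
      Fin ((minpoly ℂ A).rootMultiplicity a.1)) → ℂ) →ₗ[ℂ] E :=
    T ∘ₗ (aeval A).toLinearMap ∘ₗ Submodule.subtype _ ∘ₗ e.symm.toLinearMap
  -- `S` recovers the value from the Hermite data; expanding in the standard basis, the weights `j!`
  -- absorb those in the hypothesis on `g`.
  refine ⟨∑ s, (s.2.1.factorial : ℝ) * ‖S (Pi.single s 1)‖, by positivity, fun g B hB => ?_⟩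
  obtain ⟨hdeg, hp⟩ := hermiteInterpolant_spec g A
  have hmem : hermiteInterpolant g A ∈ degreeLT ℂ (minpoly ℂ A).natDegree := by
    rwa [mem_degreeLT, ← degree_eq_natDegree (minpoly_matrix_ne_zero A)]
  have hS : T (matrixFunction g A) = S (fun s => iteratedDeriv s.2.1 g s.1.1) := by
    have : e ⟨hermiteInterpolant g A, hmem⟩ = fun s => iteratedDeriv s.2.1 g s.1.1 :=
      funext fun s => hp s.1.1 s.2.1 s.2.2
    rw [← this]
    simp [S, matrixFunction]
  rw [hS, LinearMap.pi_apply_eq_sum_univ S, Finset.sum_mul]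
  refine (norm_sum_le _ _).trans (Finset.sum_le_sum fun s _ => ?_)
  have hroot : (minpoly ℂ A).IsRoot s.1.1 :=
    (mem_roots (minpoly_matrix_ne_zero A)).mp (Multiset.mem_toFinset.mp s.1.2)
  rw [norm_smul]
  have heq : (fun j => if s = j then (1 : ℂ) else 0) = Pi.single s 1 := by
    funext j
    simp [Pi.single_apply, eq_comm]
  rw [heq]
  calc _ ≤ B * s.2.1.factorial * ‖S (Pi.single s 1)‖ :=
        mul_le_mul_of_nonneg_right (hB _ hroot _) (norm_nonneg _)
    _ = _ := by ring

open Nat in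
theorem exists_norm_map_matrixFunction_phiSeq_le {f : ℂ → ℂ} {Ω : Set ℂ} (hconvex : Convex ℝ Ω)
    (hf : AnalyticOnNhd ℂ f Ω) {z : ℕ → ℂ} (hz : ∀ i, z i ∈ Ω) {C : ℝ} (hC : 0 ≤ C)
    (hfC : ∀ j, ∀ ζ ∈ Ω, ‖iteratedDeriv j f ζ‖ ≤ C) {n : ℕ} {A : Matrix (Fin n) (Fin n) ℂ}
    (hA : fieldOfValues A ⊆ Ω) {E : Type*} [SeminormedAddCommGroup E] [NormedSpace ℂ E]
    (T : Matrix (Fin n) (Fin n) ℂ →ₗ[ℂ] E) :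
    ∃ M : ℝ, 0 ≤ M ∧ ∀ i, ‖T (matrixFunction (phiSeq f z i) A)‖ ≤ M / i ! := by
  obtain ⟨M, hM0, hM⟩ := exists_norm_map_matrixFunction_le A T
  -- `C j! / (i + j)! ≤ (C / i!) j!`.
  refine ⟨M * C, by positivity, fun i => (hM _ (C / i !) fun a ha j => ?_).trans_eq (by ring)⟩
  refine (norm_iteratedDeriv_phiSeq_le hconvex hf hz hfC i j
    (hA (mem_fieldOfValues_of_isRoot_minpoly ha))).trans ?_
  rw [div_mul_eq_mul_div]
  gcongr
  exact Nat.le_add_right i j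

/-! ### Node polynomials evaluated at `A` -/

theorem aeval_nodePoly_succ {n : ℕ} (A : Matrix (Fin n) (Fin n) ℂ) (z : ℕ → ℂ) (i : ℕ) :
    aeval A (nodePoly z (i + 1)) = aeval A (nodePoly z i) * (A - algebraMap ℂ _ (z i)) := by
  rw [nodePoly, Finset.prod_range_succ, map_mul, ← nodePoly, map_sub, aeval_X, aeval_C]

theorem aeval_nodePoly_eq_zero {N : ℕ} {A : Matrix (Fin N) (Fin N) ℂ} {z : ℕ → ℂ}
    (h : A.charpoly.roots = (Multiset.range N).map z) {i : ℕ} (hi : N ≤ i) :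
    aeval A (nodePoly z i) = 0 := by
  have hchar : nodePoly z N = A.charpoly := by
    rw [(IsAlgClosed.splits A.charpoly).eq_prod_roots_of_monic A.charpoly_monic, h,
      Multiset.map_map]
    rfl
  have hdvd : A.charpoly ∣ nodePoly z i :=
    hchar ▸ Finset.prod_dvd_prod_of_subset _ _ _ (Finset.range_subset_range.mpr hi)
  obtain ⟨r, hr⟩ := hdvd
  rw [hr, map_mul, aeval_self_charpoly, zero_mul]

section

attribute [local instance] Matrix.linftyOpNormedRing Matrix.linftyOpNormedAlgebra

theorem exists_norm_aeval_nodePoly_mulVec_le {n : ℕ} (A : Matrix (Fin n) (Fin n) ℂ) {z : ℕ → ℂ}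
    (hz : Bornology.IsBounded (Set.range z)) :
    ∃ D R : ℝ, 0 ≤ D ∧ 0 ≤ R ∧
      ∀ i (u : Fin n → ℂ), ‖aeval A (nodePoly z i) *ᵥ u‖ ≤ D * R ^ i * ‖u‖ := by
  obtain ⟨r, hr⟩ := hz.exists_norm_le
  have hfac : ∀ i, ‖A - algebraMap ℂ (Matrix (Fin n) (Fin n) ℂ) (z i)‖ ≤
      ‖A‖ + |r| * ‖(1 : Matrix (Fin n) (Fin n) ℂ)‖ := fun i => by
    refine (norm_sub_le _ _).trans ?_
    rw [norm_algebraMap]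
    gcongr
    exact (hr _ ⟨i, rfl⟩).trans (le_abs_self r)
  -- The norm of the identity is kept because it is `0`, not `1`, when `n = 0`.
  refine ⟨‖(1 : Matrix (Fin n) (Fin n) ℂ)‖, ‖A‖ + |r| * ‖(1 : Matrix (Fin n) (Fin n) ℂ)‖,
    norm_nonneg _, by positivity, fun i u =>
    (linfty_opNorm_mulVec _ u).trans (mul_le_mul_of_nonneg_right ?_ (norm_nonneg u))⟩
  induction i with
  | zero => simp [nodePoly]
  | succ i ih =>
    rw [aeval_nodePoly_succ, pow_succ, ← mul_assoc]
    exact (norm_mul_le _ _).trans (mul_le_mul ih (hfac i) (norm_nonneg _) (by positivity))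

end

/-! ### Error recursion and expansion -/

section Expansion

variable {N n : ℕ} {A : Matrix (Fin N) (Fin N) ℂ} {v : Fin N → ℂ} {W : Matrix (Fin N) (Fin n) ℂ}
  {K : Matrix (Fin n) (Fin n) ℂ} {w : Fin N → ℂ} {k b : Fin n → ℂ} {f : ℂ → ℂ} {Ω : Set ℂ}
  {z : ℕ → ℂ}

theorem krylovError_eq_add_mulVec_dslope (hdec : A * W = W * K + vecMulVec w k) (hb : W *ᵥ b = v)
    {z₀ : ℂ} (h₀ : AnalyticAt ℂ f z₀) (hA : ∀ a ∈ fieldOfValues A, AnalyticAt ℂ f a)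
    (hK : ∀ a ∈ fieldOfValues K, AnalyticAt ℂ f a) :
    krylovError A v W K b f = (k ⬝ᵥ (matrixFunction (dslope f z₀) K *ᵥ b)) • w
      + (A - algebraMap ℂ _ z₀) *ᵥ krylovError A v W K b (dslope f z₀) := by
  have hdec' : ∀ y, A *ᵥ (W *ᵥ y) = W *ᵥ (K *ᵥ y) + (k ⬝ᵥ y) • w := fun y => by
    rw [mulVec_mulVec, hdec, add_mulVec, ← mulVec_mulVec, vecMulVec_mulVec]
    simp
  have halg : ∀ {p : ℕ} (c : ℂ) (y : Fin p → ℂ),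
      (algebraMap ℂ (Matrix (Fin p) (Fin p) ℂ) c) *ᵥ y = c • y := fun c y => by
    rw [Algebra.algebraMap_eq_smul_one, smul_mulVec, one_mulVec]
  rw [krylovError, krylovError, matrixFunction_eq_add_mul_dslope h₀ hA,
    matrixFunction_eq_add_mul_dslope h₀ hK]
  simp only [add_mulVec, sub_mulVec, ← mulVec_mulVec, halg, mulVec_add, mulVec_sub, mulVec_smul,
    hb, hdec']
  abel

theorem krylovError_eq_sum_add (hdec : A * W = W * K + vecMulVec w k) (hb : W *ᵥ b = v)
    (hf : AnalyticOnNhd ℂ f Ω) (hFA : fieldOfValues A ⊆ Ω) (hFK : fieldOfValues K ⊆ Ω)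
    (hz : ∀ i, z i ∈ Ω) (r : ℕ) :
    krylovError A v W K b f = ∑ i ∈ Finset.range r, expansionTerm A K w k b f z (i + 1)
      + aeval A (nodePoly z r) *ᵥ krylovError A v W K b (phiSeq f z r) := by
  induction r with
  | zero => simp [nodePoly, phiSeq]
  | succ r ih =>
    have han := analyticOnNhd_phiSeq hf hz r
    rw [ih, krylovError_eq_add_mulVec_dslope hdec hb (han _ (hz r)) (fun a ha => han a (hFA ha))
      (fun a ha => han a (hFK ha)), Finset.sum_range_succ, aeval_nodePoly_succ, mulVec_add,
      mulVec_smul, mulVec_mulVec, add_assoc]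
    rfl

theorem hasSum_expansionTerm (hdec : A * W = W * K + vecMulVec w k) (hb : W *ᵥ b = v)
    (hconvex : Convex ℝ Ω) (hf : AnalyticOnNhd ℂ f Ω) (hFA : fieldOfValues A ⊆ Ω)
    (hFK : fieldOfValues K ⊆ Ω) (hz : ∀ i, z i ∈ Ω) {C : ℝ} (hC : 0 ≤ C)
    (hfC : ∀ j, ∀ ζ ∈ Ω, ‖iteratedDeriv j f ζ‖ ≤ C) (hbdd : Bornology.IsBounded (Set.range z)) :
    HasSum (fun i => expansionTerm A K w k b f z (i + 1)) (krylovError A v W K b f) := by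
  obtain ⟨D, R, hD, hR, hDR⟩ := exists_norm_aeval_nodePoly_mulVec_le A hbdd
  -- `M₁` and `M₂` control the two halves of the error in the remainder; `M₃` controls the scalar
  -- coefficients of the series.
  obtain ⟨M₁, hM₁, h₁⟩ := exists_norm_map_matrixFunction_phiSeq_le hconvex hf hz hC hfC hFA
    ((mulVecBilin ℂ ℂ).flip v)
  obtain ⟨M₂, hM₂, h₂⟩ := exists_norm_map_matrixFunction_phiSeq_le hconvex hf hz hC hfC hFK
    (W.mulVecLin ∘ₗ (mulVecBilin ℂ ℂ).flip b)
  obtain ⟨M₃, hM₃, h₃⟩ := exists_norm_map_matrixFunction_phiSeq_le hconvex hf hz hC hfC hFK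
    (dotProductBilin ℂ ℂ k ∘ₗ (mulVecBilin ℂ ℂ).flip b)
  have hexp := Real.summable_pow_div_factorial R
  have hsummable : Summable fun i => expansionTerm A K w k b f z (i + 1) := by
    refine Summable.of_norm_bounded (hexp.mul_left (M₃ * D * ‖w‖)) fun i => ?_
    rw [expansionTerm, norm_smul, Nat.add_sub_cancel]
    have hi : ‖k ⬝ᵥ (matrixFunction (phiSeq f z (i + 1)) K *ᵥ b)‖ ≤ M₃ / i.factorial :=
      -- Weakening `1/(i+1)!` to `1/i!` matches the power `R ^ i` from `q_i(A)`.
      (h₃ (i + 1)).trans (by gcongr; exact i.le_succ)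
    refine (mul_le_mul hi (hDR i w) (norm_nonneg _) (by positivity)).trans_eq ?_
    ring
  have hrem : Filter.Tendsto (fun r => aeval A (nodePoly z r) *ᵥ
      krylovError A v W K b (phiSeq f z r)) Filter.atTop (nhds 0) := by
    refine squeeze_zero_norm (a := fun r => D * (M₁ + M₂) * (R ^ r / r.factorial)) (fun r => ?_)
      (by simpa using hexp.tendsto_atTop_zero.const_mul (D * (M₁ + M₂)))
    have hr : ‖krylovError A v W K b (phiSeq f z r)‖ ≤ M₁ / r.factorial + M₂ / r.factorial :=
      (norm_sub_le _ _).trans (add_le_add (h₁ r) (h₂ r))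
    refine (hDR r _).trans ((mul_le_mul_of_nonneg_left hr (by positivity)).trans_eq ?_)
    ring
  -- Partial sum plus remainder is constantly the error, which identifies the sum of the series.
  have hlim := hsummable.hasSum.tendsto_sum_nat.add hrem
  simp only [← krylovError_eq_sum_add hdec hb hf hFA hFK hz, add_zero] at hlim
  rw [tendsto_nhds_unique tendsto_const_nhds hlim]
  exact hsummable.hasSum

end Expansion

theorem mainTheorem1 {N m l : ℕ} (A : Matrix (Fin N) (Fin N) ℂ) (v : Fin N → ℂ)
    (W : Matrix (Fin N) (Fin (m + l)) ℂ) (K : Matrix (Fin (m + l)) (Fin (m + l)) ℂ)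
    (w : Fin N → ℂ) (k : Fin (m + l) → ℂ)
    (hdec : IsKrylovLikeDecomposition A v m l W K w k)
    (b : Fin (m + l) → ℂ) (hb : W *ᵥ b = v)
    (f : ℂ → ℂ) (Ω : Set ℂ) (hclosed : IsClosed Ω) (hconvex : Convex ℝ Ω)
    (hf : AnalyticOnNhd ℂ f Ω)
    (hFA : fieldOfValues A ⊆ Ω) (hFK : fieldOfValues K ⊆ Ω)
    (z : ℕ → ℂ) (hz : ∀ i, z i ∈ Ω) :
    ((∃ C : ℝ, 0 < C ∧ ∀ j : ℕ, ∀ ζ ∈ Ω, ‖iteratedDeriv j f ζ‖ ≤ C) →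
      Bornology.IsBounded (Set.range z) →
      HasSum (fun i : ℕ => expansionTerm A K w k b f z (i + 1)) (krylovError A v W K b f)) ∧
    (A.charpoly.roots = (Multiset.range N).map z →
      (∀ j, N < j → expansionTerm A K w k b f z j = 0) ∧
      krylovError A v W K b f = ∑ j ∈ Finset.Icc 1 N, expansionTerm A K w k b f z j) := by
  refine ⟨fun ⟨C, hC, hfC⟩ hbdd => hasSum_expansionTerm hdec.decomposition hb hconvex hf hFA hFK
    hz hC.le hfC hbdd, fun hroots => ⟨fun j hj => ?_, ?_⟩⟩
  · rw [expansionTerm, aeval_nodePoly_eq_zero hroots (Nat.le_sub_one_of_lt hj), zero_mulVec,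
      smul_zero]
  · rw [krylovError_eq_sum_add hdec.decomposition hb hf hFA hFK hz N,
      aeval_nodePoly_eq_zero hroots le_rfl, zero_mulVec, add_zero, Finset.range_eq_Ico,
      Finset.sum_Ico_add' (fun j => expansionTerm A K w k b f z j) 0 N 1]
    rfl
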